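/- Conventions. A simplicial poset is a finite poset $S$ with a least element $\varnothing$ such that every interval $[\varnothing,I]$ is a Boolean lattice of finite rank. Its elements are called simplices, and its elements of rank $1$ are its vertices, $\mathrm{Ver}(S)$. It is a simplicial complex if any set of vertices is the vertex set of at most one simplex. Its geometric realization $|S|$ is glued from geometric simplices $\Delta_I$, $I\in S$, according to the order. $S$ is a simplicial cell $2$-sphere if $|S|$ is homeomorphic to the $2$-sphere, and a simplicial $2$-sphere if it is moreover a simplicial complex. For $I\le J$ let $J\smallsetminus I$ be the complement of $I$ in the Boolean lattice $[\varnothing,J]$. The open star of $I$ is $\{J : J\ge I\}$, the link of $I$ is $\{J\smallsetminus I : J\ge I\}$ with the induced order, and $I$ is admissible if $J\mapsto J\smallsetminus I$ is injective on the open star of $I$. Let $\Gamma=(V,E)$ be a finite tree. For each node $v$ let $S_v$ be a simplicial cell $2$-sphere, and for each edge $e$ with endpoint $v$ let $i_{v,e}$ be an admissible vertex of $S_v$, such that for every edge $e=\{v,u\}$ an isomorphism from the link of $i_{v,e}$ in $S_v$ to the link of $i_{u,e}$ in $S_u$ is given, and such that for $e_1\ne e_2$ at $v$ the vertices $i_{v,e_1},i_{v,e_2}$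 are different and not adjacent. Let the region $R_v$ be $S_v$ with the open stars of all $i_{v,e}$ removed. The connected sum $\#_\Gamma S_v$ is the disjoint union of the regions $R_v$, where for every edge $e=\{v,u\}$ the links of $i_{v,e}$ and $i_{u,e}$ are identified by the given isomorphism, with the order induced from the regions. A slicing $\Theta$ of a simplicial $2$-sphere $K$ is a representation $K\cong\#_\Gamma S_v$ of this kind. Its width is $\mathrm{wid}(\Theta)=\max_{v\in V}|\mathrm{Ver}(R_v)|$, and the fatness of $K$ is $$\mathrm{ft}(K)=\min\{\mathrm{wid}(\Theta) : \Theta \text{ is a slicing of } K\}.$$ Proposition. For every integer $N>0$ there exists a simplicial $2$-sphere $K$ such that $\mathrm{ft}(K)>N$. -/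

import Mathlib

/-- A simplicial poset (simplicial cell complex): a finite poset with a least element `⊥`
(the empty simplex) such that every lower interval `[⊥, I]` is isomorphic to a Boolean lattice of
finite rank. Being finite, having a least element is the same as having a unique minimal one. -/
structure SimplicialPoset : Type 1 where
  /-- The set of simplices. -/
  Simplex : Type
  [partialOrder : PartialOrder Simplex]
  [orderBot : OrderBot Simplex]
  [finite : Finite Simplex]
  boolean : ∀ I : Simplex, ∃ k : ℕ, Nonempty (Set.Iic I ≃o Finset (Fin k))

namespace SimplicialPoset

instance : CoeSort SimplicialPoset Type := ⟨SimplicialPoset.Simplex⟩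

instance (S : SimplicialPoset) : PartialOrder S := S.partialOrder

instance (S : SimplicialPoset) : OrderBot S := S.orderBot

instance (S : SimplicialPoset) : Finite S := S.finite

/-- The vertices of a simplicial poset: the elements of rank one, that is, the atoms. -/
def Ver (S : SimplicialPoset) : Set S := {i | IsAtom i}

/-- A simplicial poset is a simplicial complex if every set of vertices is the vertex set
of at most one simplex. -/
def IsComplex (S : SimplicialPoset) : Prop :=
  ∀ I J : S, {i ∈ S.Ver | i ≤ I} = {i ∈ S.Ver | i ≤ J} → I = J

/-- The closed geometric simplex `Δ_I`, in barycentric coordinates: it is the face, spanned by the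
vertices of `I`, of the standard simplex on all vertices of `S`. For `I ≤ J` this makes `Δ_I`
a subset of `Δ_J`; the simplex `Δ_⊥` is empty. -/
def geomSimplex (S : SimplicialPoset) (I : S) : Set (S.Ver → ℝ) :=
  {x | (∀ i, 0 ≤ x i) ∧ ∑ᶠ i, x i = 1 ∧ ∀ i : S.Ver, ¬ (i : S) ≤ I → x i = 0}

/-- The geometric realization `|S|`: the disjoint union of the simplices `Δ_I`, where a point of
`Δ_I` is identified with the same point of `Δ_J` for `I ≤ J`. -/
def Realization (S : SimplicialPoset) : Type :=
  Quot fun p q : Σ I : S, S.geomSimplex I => p.1 ≤ q.1 ∧ (p.2 : S.Ver → ℝ) = q.2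

/-- The quotient topology, from the disjoint union of the simplices. -/
instance (S : SimplicialPoset) : TopologicalSpace S.Realization :=
  inferInstanceAs (TopologicalSpace (Quot _))

/-- A simplicial cell `d`-sphere: a simplicial poset whose geometric realization is homeomorphic
to the unit sphere of `ℝ^(d+1)`. -/
def IsCellSphere (d : ℕ) (S : SimplicialPoset) : Prop :=
  Nonempty (S.Realization ≃ₜ Metric.sphere (0 : EuclideanSpace ℝ (Fin (d + 1))) 1)

/-- A simplicial `d`-sphere: a simplicial cell `d`-sphere that is a simplicial complex. -/
def IsSphere (d : ℕ) (S : SimplicialPoset) : Prop :=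
  S.IsCellSphere d ∧ S.IsComplex

/-- `S.IsDiff J I L` says that `I ≤ J` and that `L` is the face `J ∖ I` of `J` complementary
to `I`, the complement of `I` in the Boolean lattice `[⊥, J]`. -/
def IsDiff (S : SimplicialPoset) (J I L : S) : Prop :=
  ∃ (hI : I ≤ J) (hL : L ≤ J), IsCompl (⟨I, hI⟩ : Set.Iic J) ⟨L, hL⟩

/-- The link of `I`: all `J ∖ I` for `J ≥ I`, with the order induced from `S`. -/
def link (S : SimplicialPoset) (I : S) : Set S := {L | ∃ J, S.IsDiff J I L}

/-- The open star of `I`: all simplices `J ≥ I`. -/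
def openStar (S : SimplicialPoset) (I : S) : Set S := {J | I ≤ J}

/-- A simplex `I` is admissible if the map `J ↦ J ∖ I` from its open star to its link is
injective. -/
def Admissible (S : SimplicialPoset) (I : S) : Prop :=
  ∀ J J' L : S, S.IsDiff J I L → S.IsDiff J' I L → J = J'

/-- Two different vertices are adjacent if they are vertices of a common simplex (equivalently, of
a common edge, as the lower intervals are Boolean). -/
def Adjacent (S : SimplicialPoset) (i j : S) : Prop :=
  i ≠ j ∧ ∃ J : S, i ≤ J ∧ j ≤ J

end SimplicialPoset

/-- The data for a connected sum of simplicial cell `d`-spheres along a finite tree. An edge `e` of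
the tree with endpoint `v` is given by `v` and the other endpoint `u`. -/
structure TreeSumData (d : ℕ) : Type 1 where
  /-- The nodes of the tree. -/
  Node : Type
  [fintypeNode : Fintype Node]
  /-- The tree. -/
  tree : SimpleGraph Node
  isTree : tree.IsTree
  /-- The simplicial cell sphere `S_v` at the node `v`. -/
  piece : Node → SimplicialPoset
  isCellSphere : ∀ v, (piece v).IsCellSphere d
  /-- The vertex `i_{v,e}` of `S_v`, where `e = {v, u}`. -/
  mark : ∀ v u : Node, tree.Adj v u → piece v
  mark_mem : ∀ v u h, mark v u h ∈ (piece v).Ver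
  admissible : ∀ v u h, (piece v).Admissible (mark v u h)
  /-- The isomorphism of the links of `i_{v,e}` and `i_{u,e}`, where `e = {v, u}`. -/
  glue : ∀ v u h, (piece v).link (mark v u h) ≃o (piece u).link (mark u v h.symm)
  /-- There is one isomorphism for each edge, read in both directions. -/
  glue_symm : ∀ v u h, glue u v h.symm = (glue v u h).symm
  mark_ne : ∀ v u u' h h', u ≠ u' → mark v u h ≠ mark v u' h'
  not_adjacent : ∀ v u u' h h', u ≠ u' → ¬ (piece v).Adjacent (mark v u h) (mark v u' h')

namespace TreeSumData

variable {d : ℕ}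

instance (D : TreeSumData d) : Fintype D.Node := D.fintypeNode

/-- The region `R_v`: the subposet `S_v` without the open stars of the vertices `i_{v,e}`,
where `e` runs through the edges at `v`. -/
def region (D : TreeSumData d) (v : D.Node) : Set (D.piece v) :=
  {I | ∀ u h, I ∉ (D.piece v).openStar (D.mark v u h)}

/-- The identifications that define the connected sum: for an edge `{v, u}`, every simplex of the
link of `i_{v,e}` in `R_v` is identified with its image in the link of `i_{u,e}` in `R_u`. -/
def Identified (D : TreeSumData d) (p q : Σ v, D.region v) : Prop :=
  ∃ (h : D.tree.Adj p.1 q.1) (hp : (p.2 : D.piece p.1) ∈ (D.piece p.1).link (D.mark p.1 q.1 h)),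
    ((D.glue p.1 q.1 h ⟨p.2, hp⟩ : (D.piece q.1).link (D.mark q.1 p.1 h.symm)) : D.piece q.1) = q.2

/-- The connected sum along the tree: the disjoint union of the regions, glued along the links. -/
def Sum (D : TreeSumData d) : Type := Quot D.Identified

/-- The class in the connected sum of a simplex of a region. -/
def toSum (D : TreeSumData d) (v : D.Node) (I : D.region v) : D.Sum := Quot.mk _ ⟨v, I⟩

/-- The order of the connected sum is induced from the regions. -/
instance (D : TreeSumData d) : LE D.Sum :=
  ⟨fun a b => ∃ (v : D.Node) (I J : D.region v), I ≤ J ∧ D.toSum v I = a ∧ D.toSum v J = b⟩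

/-- The maximal number of vertices in a region. -/
noncomputable def width (D : TreeSumData d) : ℕ :=
  Finset.univ.sup fun v => (D.region v ∩ (D.piece v).Ver).ncard

end TreeSumData

/-- A slicing of `K` is a representation of `K`, up to isomorphism, as a connected sum of
simplicial cell `d`-spheres along a finite tree. -/
structure Slicing (d : ℕ) (K : SimplicialPoset) : Type 1 where
  data : TreeSumData d
  iso : K ≃o data.Sum

/-- The fatness of a (simplicial cell) `d`-sphere: the minimal width of its slicings. A cell sphere
has at least the slicing with a single node. -/
noncomputable def fatness (d : ℕ) (K : SimplicialPoset) : ℕ :=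
  sInf {w | ∃ Θ : Slicing d K, Θ.data.width = w}

/-! A slicing of `K` is a tree decomposition of its edge graph, with the regions as bags. The nodes
whose regions contain a given simplex are linked in the tree, because every identification crosses
one edge of the tree (`isLinked_support`). The node sets of two vertices of a common simplex meet
(`support_inter_nonempty`). If `K` contains a square grid with `2m+1` rows and columns, the node
sets along a cross (one row and one column) unite to a linked set, and any two crosses meet. By the
Helly property of subtrees some node lies in the sets of all crosses, hence meets all rows or all
columns. Its region then has at least `2m+1` vertices (`width_ge_of_grid`).

A sphere with such a grid is the boundary of `[-m, m]³` in the Freudenthal triangulation, the grid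
being its top facet. To see that it is a sphere, barycentric coordinates are mapped to points of the
sup-norm sphere of radius `m`. The map is injective because the point determines the total weight
above each vertex (`sum_le_eq_of_point_eq`). It is surjective because, for `s` uniform in `[0, 1)`,
the rounded points `⌊x + s⌋` run through a chain and have mean `x`, so their distribution gives
barycentric coordinates of `x`. -/

namespace SimpleGraph

/-! ### Subtrees of a tree and tree decompositions of grids -/

variable {V ι : Type*} {G : SimpleGraph V}

/-- A set of vertices is linked if any two of its elements are joined by a walk inside it. -/
def IsLinked (G : SimpleGraph V) (C : Set V) : Prop :=
  ∀ x ∈ C, ∀ y ∈ C, Relation.ReflTransGen (fun a b => G.Adj a b ∧ b ∈ C) x y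

/-- The neighbour `u` of `v` leads to `x` if a walk from `u` to `x` avoids `v`. -/
def LeadsTo (G : SimpleGraph V) (v u x : V) : Prop :=
  G.Adj v u ∧ ∃ p : G.Walk u x, v ∉ p.support

theorem LeadsTo.step {v u x y : V} (h : G.LeadsTo v u x) (hxy : G.Adj x y) (hy : y ≠ v) :
    G.LeadsTo v u y := by
  obtain ⟨hvu, p, hp⟩ := h
  refine ⟨hvu, p.append (Walk.cons hxy Walk.nil), ?_⟩
  rw [Walk.mem_support_append_iff]
  rintro (h | h)
  · exact hp h
  · simp only [Walk.support_cons, Walk.support_nil, List.mem_cons, List.not_mem_nil,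
      or_false] at h
    rcases h with rfl | rfl
    · exact hp p.end_mem_support
    · exact hy rfl

theorem exists_leadsTo (hG : G.Connected) {v x : V} (h : x ≠ v) : ∃ u, G.LeadsTo v u x := by
  obtain ⟨p, hp⟩ := hG.exists_isPath v x
  cases p with
  | nil => exact absurd rfl h
  | cons hvu q => exact ⟨_, hvu, q, ((Walk.cons_isPath_iff _ _).1 hp).2⟩

/-- Otherwise there would be two paths from `v` to `x`, one starting with the edge to `u` and one
avoiding `u`. -/
theorem LeadsTo.asymm (hG : G.IsAcyclic) {v u x : V} (h : G.LeadsTo v u x)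
    (h' : G.LeadsTo u v x) : False := by
  classical
  obtain ⟨hvu, p, hp⟩ := h
  obtain ⟨-, q, hq⟩ := h'
  have h1 : (Walk.cons hvu p.bypass).IsPath :=
    (Walk.cons_isPath_iff _ _).2
      ⟨p.bypass_isPath, fun h => hp (p.support_bypass_subset_support h)⟩
  have h2 := (hG.subsingleton_path v x).elim ⟨_, h1⟩ ⟨_, q.bypass_isPath⟩
  have h3 : u ∈ q.bypass.support := by
    rw [← show Walk.cons hvu p.bypass = q.bypass from congrArg Subtype.val h2]
    simp
  exact hq (q.support_bypass_subset_support h3)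

/-- A walk inside `C` never passes through `v`, so it cannot leave its branch at `v`. -/
theorem IsLinked.exists_leadsTo (hG : G.Connected) {C : Set V} (hC : G.IsLinked C)
    (hne : C.Nonempty) {v : V} (hv : v ∉ C) : ∃ u, ∀ x ∈ C, G.LeadsTo v u x := by
  obtain ⟨x, hx⟩ := hne
  obtain ⟨u, hu⟩ := SimpleGraph.exists_leadsTo hG (show x ≠ v from fun h => hv (h ▸ hx))
  refine ⟨u, fun y hy => ?_⟩
  induction hC x hx y hy with
  | refl => exact hu
  | tail _ h ih => exact (ih (by
      rename_i b c hb
      cases hb with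
      | refl => exact hx
      | tail _ h => exact h.2)).step h.1 (fun e => hv (e ▸ h.2))

/-- The Helly property of subtrees of a finite tree. -/
theorem IsTree.helly [Finite V] (hG : G.IsTree) (C : ι → Set V) (hC : ∀ i, G.IsLinked (C i))
    (hpair : ∀ i j, (C i ∩ C j).Nonempty) : ∃ v, ∀ i, v ∈ C i := by
  classical
  have := Fintype.ofFinite V
  by_contra! hcon
  choose i hi using hcon
  have hne : ∀ i, (C i).Nonempty := fun i => (hpair i i).mono Set.inter_subset_left
  choose u hu using fun v => (hC (i v)).exists_leadsTo hG.connected (hne _) (hi v)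
  have hadj : ∀ v, G.Adj v (u v) := fun v => (hu v _ (hne (i v)).some_mem).1
  -- Each node `v` is missed by `C (i v)` and points along an edge to the branch containing it. A
  -- tree has fewer edges than nodes, so two nodes point along the same edge, from opposite ends.
  -- Their two sets then lie on opposite sides of that edge, yet they meet.
  obtain ⟨v, w, hvw, he⟩ := Fintype.exists_ne_map_eq_of_card_lt
    (fun v => (⟨s(v, u v), by simpa using hadj v⟩ : G.edgeFinset)) (by
      have := hG.card_edgeFinset
      rw [Fintype.card_coe]; omega)
  simp only [Subtype.mk.injEq, Sym2.eq_iff, hvw, false_and, false_or] at he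
  obtain ⟨x, hx, hx'⟩ := hpair (i v) (i w)
  have h1 := hu v x hx
  have h2 := hu w x hx'
  rw [he.2] at h1
  rw [← he.1] at h2
  exact h1.asymm hG.isAcyclic h2

theorem IsLinked.biUnion {T : ι → Set V} (hT : ∀ g, G.IsLinked (T g)) {B : Set ι}
    (hB : ∀ g ∈ B, ∀ h ∈ B, Relation.ReflTransGen
      (fun a b => b ∈ B ∧ (T a ∩ T b).Nonempty) g h) :
    G.IsLinked (⋃ g ∈ B, T g) := by
  have key : ∀ g ∈ B, ∀ x ∈ T g, ∀ y ∈ T g, Relation.ReflTransGen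
      (fun a b => G.Adj a b ∧ b ∈ ⋃ g ∈ B, T g) x y := fun g hg x hx y hy =>
    Relation.ReflTransGen.mono (fun a b h => ⟨h.1, Set.mem_biUnion hg h.2⟩) x y (hT g x hx y hy)
  intro x hx y hy
  simp only [Set.mem_iUnion, exists_prop] at hx hy
  obtain ⟨g, hg, hx⟩ := hx
  obtain ⟨h, hh, hy⟩ := hy
  have hgh := hB g hg h hh
  clear hh
  induction hgh generalizing y with
  | refl => exact key g hg x hx y hy
  | tail _ hbc ih =>
    obtain ⟨z, hz, hz'⟩ := hbc.2
    exact (ih z hz).trans (key _ hbc.1 z hz' y hy)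

theorem reflTransGen_segment {r : ℤ → ℤ → Prop} {m : ℤ} (hsymm : ∀ a b, r a b → r b a)
    (hr : ∀ p, -m ≤ p → p + 1 ≤ m → r p (p + 1)) {p q : ℤ} (hp : p ∈ Set.Icc (-m) m)
    (hq : q ∈ Set.Icc (-m) m) :
    Relation.ReflTransGen (fun a b => b ∈ Set.Icc (-m) m ∧ r a b) p q := by
  have up : ∀ n : ℕ, ∀ p : ℤ, -m ≤ p → p + n ≤ m →
      Relation.ReflTransGen (fun a b => b ∈ Set.Icc (-m) m ∧ r a b) p (p + n) ∧
      Relation.ReflTransGen (fun a b => b ∈ Set.Icc (-m) m ∧ r a b) (p + n) p := by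
    intro n
    induction n with
    | zero => intro p _ _; simp [Relation.ReflTransGen.refl]
    | succ n ih =>
      intro p h1 h2
      push_cast at h2 ⊢
      obtain ⟨h3, h4⟩ := ih p h1 (by omega)
      rw [← add_assoc]
      have h5 := hr (p + n) (by omega) (by omega)
      exact ⟨h3.tail ⟨⟨by omega, by omega⟩, h5⟩,
        h4.head ⟨⟨by omega, by omega⟩, hsymm _ _ h5⟩⟩
  rcases le_total p q with h | h
  · obtain ⟨n, rfl⟩ := Int.le.dest h
    exact (up n p hp.1 hq.2).1
  · obtain ⟨n, rfl⟩ := Int.le.dest h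
    exact (up n q hq.1 hp.2).2

/-- In a tree decomposition of a square grid some bag meets all rows or all columns. -/
theorem IsTree.exists_bag_meets_grid [Finite V] (hG : G.IsTree) {m : ℤ}
    (T : ℤ × ℤ → Set V) (hT : ∀ g, G.IsLinked (T g))
    (hne : ∀ p ∈ Set.Icc (-m) m, ∀ q ∈ Set.Icc (-m) m, (T (p, q)).Nonempty)
    (hrow : ∀ p ∈ Set.Icc (-m) m, ∀ q, -m ≤ q → q + 1 ≤ m →
      (T (p, q) ∩ T (p, q + 1)).Nonempty)
    (hcol : ∀ q ∈ Set.Icc (-m) m, ∀ p, -m ≤ p → p + 1 ≤ m →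
      (T (p, q) ∩ T (p + 1, q)).Nonempty) :
    ∃ v, (∀ p ∈ Set.Icc (-m) m, ∃ q ∈ Set.Icc (-m) m, v ∈ T (p, q)) ∨
      (∀ q ∈ Set.Icc (-m) m, ∃ p ∈ Set.Icc (-m) m, v ∈ T (p, q)) := by
  let I := Set.Icc (-m) m
  let B : I × I → Set (ℤ × ℤ) := fun c =>
    {g | g.1 ∈ I ∧ g.2 ∈ I ∧ (g.1 = c.1 ∨ g.2 = c.2)}
  have hBsymm : ∀ c, Std.Symm fun a b : ℤ × ℤ => (a ∈ B c ∧ b ∈ B c) ∧ (T a ∩ T b).Nonempty :=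
    fun c => ⟨fun a b h => ⟨h.1.symm, Set.inter_comm (T a) _ ▸ h.2⟩⟩
  -- Every grid point of the cross `B c` is joined to its centre along one of the two arms.
  have hB : ∀ c, ∀ g ∈ B c, Relation.ReflTransGen
      (fun a b => (a ∈ B c ∧ b ∈ B c) ∧ (T a ∩ T b).Nonempty) g (c.1, c.2) := by
    rintro ⟨⟨a, ha⟩, ⟨b, hb⟩⟩ ⟨p, q⟩ ⟨hp, hq, h⟩
    rcases h with h | h
    · simp only at h hp hq
      subst h
      refine Relation.ReflTransGen.lift' (fun q => ((p, q) : ℤ × ℤ)) ?_ _ _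
        (reflTransGen_segment
        (r := fun q q' => (q ∈ I ∧ q' ∈ I) ∧ (T (p, q) ∩ T (p, q')).Nonempty)
        (fun _ _ h => ⟨h.1.symm, Set.inter_comm (T _) _ ▸ h.2⟩)
        (fun q h1 h2 => ⟨⟨⟨h1, by omega⟩, ⟨by omega, h2⟩⟩, hrow p ha q h1 h2⟩) hq hb)
      exact fun x y hxy => .single ⟨⟨⟨ha, hxy.2.1.1, Or.inl rfl⟩, ⟨ha, hxy.2.1.2, Or.inl rfl⟩⟩,
        hxy.2.2⟩
    · simp only at h hp hq
      subst h
      refine Relation.ReflTransGen.lift' (fun p => ((p, q) : ℤ × ℤ)) ?_ _ _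
        (reflTransGen_segment
        (r := fun p p' => (p ∈ I ∧ p' ∈ I) ∧ (T (p, q) ∩ T (p', q)).Nonempty)
        (fun _ _ h => ⟨h.1.symm, Set.inter_comm (T _) _ ▸ h.2⟩)
        (fun p h1 h2 => ⟨⟨⟨h1, by omega⟩, ⟨by omega, h2⟩⟩, hcol q hb p h1 h2⟩) hp ha)
      exact fun x y hxy => .single ⟨⟨⟨hxy.2.1.1, hb, Or.inr rfl⟩, ⟨hxy.2.1.2, hb, Or.inr rfl⟩⟩,
        hxy.2.2⟩
  obtain ⟨v, hv⟩ := hG.helly (fun c : I × I => ⋃ g ∈ B c, T g)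
    (fun c => IsLinked.biUnion hT fun g hg h hh =>
      Relation.ReflTransGen.mono (fun a b hab => ⟨hab.1.2, hab.2⟩) g h
        ((hB c g hg).trans ((have := hBsymm c; Relation.ReflTransGen.stdSymm).symm _ _
          (hB c h hh))))
    (by
      rintro ⟨⟨a, ha⟩, ⟨b, hb⟩⟩ ⟨⟨a', ha'⟩, ⟨b', hb'⟩⟩
      -- The row of the first cross meets the column of the second at `(a, b')`.
      obtain ⟨x, hx⟩ := hne a ha b' hb'
      exact ⟨x, Set.mem_biUnion (show (a, b') ∈ _ from ⟨ha, hb', Or.inl rfl⟩) hx,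
        Set.mem_biUnion (show (a, b') ∈ _ from ⟨ha, hb', Or.inr rfl⟩) hx⟩)
  -- If `v` misses row `p`, then for each `q` the cross of row `p` and column `q` can be met only in
  -- its column.
  refine ⟨v, or_iff_not_imp_left.2 fun hrows => ?_⟩
  push Not at hrows
  obtain ⟨p, hp, hpq⟩ := hrows
  intro q hq
  have := hv ⟨⟨p, hp⟩, ⟨q, hq⟩⟩
  simp only [Set.mem_iUnion, exists_prop] at this
  obtain ⟨⟨a, b⟩, ⟨ha, hb, h⟩, hg⟩ := this
  rcases h with h | h
  · simp only at h
    subst h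
    exact absurd hg (hpq b hb)
  · simp only at h
    subst h
    exact ⟨a, ha, hg⟩

end SimpleGraph

/-! ### Complements and faces in links -/

namespace SimplicialPoset

variable {S : SimplicialPoset}

theorem isDiff_iff {J I L : S} : S.IsDiff J I L ↔
    I ≤ J ∧ L ≤ J ∧ (∀ X, X ≤ I → X ≤ L → X = ⊥) ∧ (∀ X, X ≤ J → I ≤ X → L ≤ X → X = J) := by
  constructor
  · rintro ⟨hI, hL, hc⟩
    refine ⟨hI, hL, fun X h1 h2 => ?_, fun X h0 h1 h2 => ?_⟩
    · have := @hc.disjoint ⟨X, h1.trans hI⟩ h1 h2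
      exact le_bot_iff.1 this
    · exact le_antisymm h0 (@hc.codisjoint ⟨X, h0⟩ h1 h2)
  · rintro ⟨hI, hL, h1, h2⟩
    refine ⟨hI, hL, ⟨fun X hXI hXL => ?_, fun X hXI hXL => ?_⟩⟩
    · exact (h1 X hXI hXL).le
    · exact (h2 X X.2 hXI hXL).ge

/-- The witness is the join `M` of `I` and `L'` inside the Boolean lattice `[⊥, J]`. -/
theorem mem_link_of_le {I L L' : S} (hL : L ∈ S.link I) (h : L' ≤ L) : L' ∈ S.link I := by
  obtain ⟨J, hJ⟩ := hL
  obtain ⟨hIJ, hLJ, hinf, -⟩ := isDiff_iff.1 hJ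
  obtain ⟨k, ⟨e⟩⟩ := S.boolean J
  let I₀ : Set.Iic J := ⟨I, hIJ⟩
  let L₀ : Set.Iic J := ⟨L', h.trans hLJ⟩
  let M : Set.Iic J := e.symm (e I₀ ⊔ e L₀)
  have hI : I₀ ≤ M := e.le_symm_apply.2 le_sup_left
  have hL : L₀ ≤ M := e.le_symm_apply.2 le_sup_right
  refine ⟨M, isDiff_iff.2 ⟨hI, hL, fun X h1 h2 => hinf X h1 (h2.trans h), fun X h0 h1 h2 => ?_⟩⟩
  refine le_antisymm h0 ?_
  have hX : X ≤ J := h0.trans M.2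
  exact e.symm_apply_le.2 (sup_le (e.monotone (show I₀ ≤ ⟨X, hX⟩ from h1))
    (e.monotone (show L₀ ≤ ⟨X, hX⟩ from h2)))

end SimplicialPoset

/-! ### Connected sums as tree decompositions -/

namespace TreeSumData

variable {d : ℕ} (D : TreeSumData d)

theorem bot_mem_region (v : D.Node) : ⊥ ∈ D.region v := fun u h hle =>
  (D.mark_mem v u h).1 (le_bot_iff.1 hle)

theorem mem_region_of_le {v : D.Node} {I J : D.piece v} (hJ : J ∈ D.region v) (h : I ≤ J) :
    I ∈ D.region v := fun u hu hI => hJ u hu (le_trans hI h)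

variable {D}

theorem Identified.symm {p q : Σ v, D.region v} (h : D.Identified p q) : D.Identified q p := by
  obtain ⟨h, hp, he⟩ := h
  refine ⟨h.symm, he ▸ Subtype.coe_prop _, ?_⟩
  rw [D.glue_symm p.1 q.1 h]
  have : (⟨q.2, he ▸ Subtype.coe_prop _⟩ : (D.piece q.1).link (D.mark q.1 p.1 h.symm)) =
      D.glue p.1 q.1 h ⟨p.2, hp⟩ := Subtype.ext he.symm
  rw [this, OrderIso.symm_apply_apply]

/-- Faces can be moved along an identification. -/
theorem Identified.exists_of_le {p q : Σ v, D.region v} (h : D.Identified p q)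
    {I : D.region p.1} (hI : I ≤ p.2) :
    ∃ I' : D.region q.1, I' ≤ q.2 ∧ D.Identified ⟨p.1, I⟩ ⟨q.1, I'⟩ := by
  obtain ⟨h, hp, he⟩ := h
  have hI' := SimplicialPoset.mem_link_of_le hp hI
  have hle : ((D.glue p.1 q.1 h ⟨I, hI'⟩ : (D.piece q.1).link _) : D.piece q.1) ≤ q.2 := by
    rw [← he]
    exact (D.glue p.1 q.1 h).monotone (show (⟨I, hI'⟩ : (D.piece p.1).link _) ≤ ⟨p.2, hp⟩ from hI)
  exact ⟨⟨_, D.mem_region_of_le q.2.2 hle⟩, hle, h, hI', rfl⟩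

/-- The number of faces serves as a rank that identifications preserve. It separates comparable
simplices of one region. -/
theorem Identified.ncard_Iic_le {p q : Σ v, D.region v} (h : D.Identified p q) :
    (Set.Iic (p.2 : D.piece p.1)).ncard ≤ (Set.Iic (q.2 : D.piece q.1)).ncard := by
  classical
  obtain ⟨h, hp, he⟩ := h
  refine Set.ncard_le_ncard_of_injOn (fun I => if hI : I ≤ p.2 then
    (D.glue p.1 q.1 h ⟨I, SimplicialPoset.mem_link_of_le hp hI⟩ : D.piece q.1) else ⊥) ?_ ?_
  · intro I hI
    have hI : I ≤ p.2 := hI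
    simp only [hI, dite_true]
    change _ ≤ _
    rw [← he]
    exact (D.glue p.1 q.1 h).monotone hI
  · intro I hI I' hI' hII
    have hI : I ≤ p.2 := hI
    have hI' : I' ≤ p.2 := hI'
    simp only [hI, hI', dite_true] at hII
    simpa using (D.glue p.1 q.1 h).injective (Subtype.ext hII)

theorem toSum_eq_iff {v w : D.Node} {I : D.region v} {J : D.region w} :
    D.toSum v I = D.toSum w J ↔ Relation.ReflTransGen D.Identified ⟨v, I⟩ ⟨w, J⟩ := by
  constructor
  · intro h
    have := Quot.eqvGen_exact h
    have hs : Std.Symm D.Identified := ⟨fun _ _ h => h.symm⟩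
    rwa [Relation.EqvGen.eqvGen_eq_reflTransGen] at this
  · intro h
    generalize hp : (⟨v, I⟩ : Σ v, D.region v) = p, hq : (⟨w, J⟩ : Σ v, D.region v) = q at h
    change Quot.mk _ _ = Quot.mk _ _
    rw [hp, hq]
    clear hp hq
    induction h with
    | refl => rfl
    | tail _ h ih => exact ih.trans (Quot.sound h)

theorem ncard_Iic_eq {v w : D.Node} {I : D.region v} {J : D.region w}
    (h : D.toSum v I = D.toSum w J) :
    (Set.Iic (I : D.piece v)).ncard = (Set.Iic (J : D.piece w)).ncard := by
  have := toSum_eq_iff.1 h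
  have key : ∀ p q : Σ v, D.region v, Relation.ReflTransGen D.Identified p q →
      (Set.Iic (p.2 : D.piece p.1)).ncard = (Set.Iic (q.2 : D.piece q.1)).ncard := by
    intro p q hpq
    induction hpq with
    | refl => rfl
    | tail _ h ih => exact ih.trans (le_antisymm h.ncard_Iic_le h.symm.ncard_Iic_le)
  exact key _ _ this

theorem exists_le_of_toSum_eq {v w : D.Node} {I J : D.region v} {J' : D.region w}
    (h : D.toSum v J = D.toSum w J') (hI : I ≤ J) :
    ∃ I' : D.region w, I' ≤ J' ∧ D.toSum v I = D.toSum w I' := by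
  have := toSum_eq_iff.1 h
  clear h
  have key : ∀ p q : Σ v, D.region v, Relation.ReflTransGen D.Identified p q →
      ∀ I : D.region p.1, I ≤ p.2 → ∃ I' : D.region q.1, I' ≤ q.2 ∧
      D.toSum p.1 I = D.toSum q.1 I' := by
    intro p q hpq I hI
    induction hpq with
    | refl => exact ⟨I, hI, rfl⟩
    | tail _ h ih =>
      obtain ⟨I', hI', he⟩ := ih
      obtain ⟨I'', hI'', he'⟩ := h.exists_of_le hI'
      exact ⟨I'', hI'', he.trans (Quot.sound he')⟩
  exact key _ _ this I hI

/-- The nodes whose regions contain a given simplex of the connected sum. -/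
def support (D : TreeSumData d) (a : D.Sum) : Set D.Node := {v | ∃ I, D.toSum v I = a}

theorem support_nonempty (a : D.Sum) : (D.support a).Nonempty := by
  obtain ⟨⟨v, I⟩, rfl⟩ := Quot.exists_rep a
  exact ⟨v, I, rfl⟩

theorem isLinked_support (a : D.Sum) : D.tree.IsLinked (D.support a) := by
  rintro v ⟨I, rfl⟩ w ⟨J, hJ⟩
  have h := toSum_eq_iff.1 hJ.symm
  have key : ∀ q, Relation.ReflTransGen D.Identified ⟨v, I⟩ q →
      D.toSum q.1 q.2 = D.toSum v I ∧
      Relation.ReflTransGen (fun a b => D.tree.Adj a b ∧ b ∈ D.support (D.toSum v I)) v q.1 := by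
    intro q hq
    induction hq with
    | refl => exact ⟨rfl, .refl⟩
    | tail _ h ih =>
      have he := (Quot.sound h).symm.trans ih.1
      exact ⟨he, ih.2.tail ⟨h.1, _, he⟩⟩
  exact (key _ h).2

/-- Any region containing `c` contains its faces, and a face seen in one representative of `c` moves
to every other one. -/
theorem support_inter_nonempty {a b c : D.Sum} (ha : a ≤ c) (hb : b ≤ c) :
    (D.support a ∩ D.support b).Nonempty := by
  obtain ⟨v, I, J, hIJ, rfl, rfl⟩ := ha
  obtain ⟨w, I', J', hIJ', rfl, he⟩ := hb
  obtain ⟨I'', -, he'⟩ := exists_le_of_toSum_eq he hIJ'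
  exact ⟨v, ⟨I, rfl⟩, ⟨I'', he'.symm⟩⟩

theorem toSum_le_toSum {v : D.Node} {I J : D.region v} (h : I ≤ J) : D.toSum v I ≤ D.toSum v J :=
  ⟨v, I, J, h, rfl, rfl⟩

end TreeSumData

/-! ### Vertices of the sphere inside a region -/

namespace Slicing

variable {d : ℕ} {K : SimplicialPoset} (Θ : Slicing d K)

/-- The order axioms of the connected sum are available only through `Θ.iso`, so region simplices
are compared through their images in `K`. -/
theorem isAtom_of_toSum_eq {i : K} (hi : IsAtom i) {v : Θ.data.Node} {I : Θ.data.region v}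
    (h : Θ.data.toSum v I = Θ.iso i) : IsAtom (I : Θ.data.piece v) := by
  let D := Θ.data
  let B : D.region v := ⟨⊥, D.bot_mem_region v⟩
  have mono : ∀ A A' : D.region v, A ≤ A' →
      Θ.iso.symm (D.toSum v A) ≤ Θ.iso.symm (D.toSum v A') := fun A A' h =>
    Θ.iso.symm.map_rel_iff.2 (TreeSumData.toSum_le_toSum h)
  have hI : Θ.iso.symm (D.toSum v I) = i := by
    rw [h]; exact Θ.iso.toEquiv.symm_apply_apply i
  -- Nested simplices of one class have equally many faces, so their finite sets of faces coincide.
  have inj : ∀ A A' : D.region v, A ≤ A' → Θ.iso.symm (D.toSum v A) =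
      Θ.iso.symm (D.toSum v A') → A = A' := by
    intro A A' hle he
    have := TreeSumData.ncard_Iic_eq (Θ.iso.symm.toEquiv.injective he)
    have h2 := Set.eq_of_subset_of_ncard_le (Set.Iic_subset_Iic.2
      (show (A : D.piece v) ≤ A' from hle)) this.ge
    exact Subtype.ext (Set.Iic_injective h2)
  -- A representative of the least class moves to a face of `⊥` in the region, which can only be
  -- `⊥`.
  have hbot : Θ.iso.symm (D.toSum v B) = ⊥ := by
    obtain ⟨w, A, A', hA, h1, h2⟩ : Θ.iso ⊥ ≤ D.toSum v B := by
      have := Θ.iso.map_rel_iff.2 (bot_le (a := Θ.iso.symm (D.toSum v B)))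
      rwa [show Θ.iso (Θ.iso.symm (D.toSum v B)) = D.toSum v B from
        Θ.iso.toEquiv.apply_symm_apply _] at this
    obtain ⟨A'', hA'', h3⟩ := TreeSumData.exists_le_of_toSum_eq h2 hA
    have : A'' = B := le_antisymm hA'' (show (⊥ : D.piece v) ≤ A'' from bot_le)
    rw [← this, ← h3, h1]
    exact Θ.iso.toEquiv.symm_apply_apply ⊥
  constructor
  · intro h0
    have : I = B := Subtype.ext h0
    rw [this, hbot] at hI
    exact hi.1 hI.symm
  · intro A hA
    let A' : D.region v := ⟨A, D.mem_region_of_le I.2 hA.le⟩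
    have h1 : Θ.iso.symm (D.toSum v A') ≤ i := hI ▸ mono A' I hA.le
    rcases hi.le_iff.1 h1 with h2 | h2
    · have := inj B A' (show (⊥ : D.piece v) ≤ A from bot_le) (hbot.trans h2.symm)
      exact congrArg Subtype.val this.symm
    · have := inj A' I hA.le (h2.trans hI.symm)
      exact absurd (congrArg Subtype.val this) hA.ne

/-- The vertices of `K` that come from a region are at most as many as the width. -/
theorem ncard_le_width {A : Set K} (hA : A ⊆ K.Ver) {v : Θ.data.Node}
    (hv : ∀ i ∈ A, v ∈ Θ.data.support (Θ.iso i)) : A.ncard ≤ Θ.data.width := by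
  classical
  have : Nonempty (Θ.data.region v) := ⟨⟨⊥, Θ.data.bot_mem_region v⟩⟩
  choose! f hf using hv
  have h1 : A.ncard ≤ (Θ.data.region v ∩ (Θ.data.piece v).Ver).ncard := by
    refine Set.ncard_le_ncard_of_injOn (fun i => (f i : Θ.data.piece v))
      (fun i hi => ⟨(f i).2, Θ.isAtom_of_toSum_eq (hA hi) (hf i hi)⟩) ?_
    intro i hi j hj hij
    have : f i = f j := Subtype.ext hij
    exact Θ.iso.toEquiv.injective ((hf i hi).symm.trans (this ▸ hf j hj))
  exact h1.trans (Finset.le_sup (f := fun v =>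
    (Θ.data.region v ∩ (Θ.data.piece v).Ver).ncard) (Finset.mem_univ v))

/-- A sphere whose vertices and edges contain a square grid has only wide slicings. -/
theorem width_ge_of_grid {m : ℤ} (hm : 0 ≤ m) (g : ℤ × ℤ → K)
    (hg : Set.InjOn g (Set.Icc (-m) m ×ˢ Set.Icc (-m) m))
    (hver : ∀ p ∈ Set.Icc (-m) m, ∀ q ∈ Set.Icc (-m) m, g (p, q) ∈ K.Ver)
    (hrow : ∀ p ∈ Set.Icc (-m) m, ∀ q, -m ≤ q → q + 1 ≤ m →
      ∃ J, g (p, q) ≤ J ∧ g (p, q + 1) ≤ J)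
    (hcol : ∀ q ∈ Set.Icc (-m) m, ∀ p, -m ≤ p → p + 1 ≤ m →
      ∃ J, g (p, q) ≤ J ∧ g (p + 1, q) ≤ J) :
    2 * m + 1 ≤ Θ.data.width := by
  have hcard : ((Set.Icc (-m) m).ncard : ℤ) = 2 * m + 1 := by
    rw [← Nat.card_coe_set_eq, Nat.card_eq_fintype_card, Fintype.card_ofFinset, Int.card_Icc]
    omega
  have hsupp : ∀ i j, (∃ J, i ≤ J ∧ j ≤ J) →
      (Θ.data.support (Θ.iso i) ∩ Θ.data.support (Θ.iso j)).Nonempty := by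
    rintro i j ⟨J, hi, hj⟩
    exact TreeSumData.support_inter_nonempty (Θ.iso.map_rel_iff.2 hi) (Θ.iso.map_rel_iff.2 hj)
  obtain ⟨v, hv⟩ := Θ.data.isTree.exists_bag_meets_grid
    (fun x => Θ.data.support (Θ.iso (g x))) (fun _ => TreeSumData.isLinked_support _)
    (fun _ _ _ _ => TreeSumData.support_nonempty _)
    (fun p hp q h1 h2 => hsupp _ _ (hrow p hp q h1 h2))
    (fun q hq p h1 h2 => hsupp _ _ (hcol q hq p h1 h2))
  rw [← hcard]
  rcases hv with hv | hv
  · choose! q hq hvq using hv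
    have := Θ.ncard_le_width (A := (fun p => g (p, q p)) '' Set.Icc (-m) m) (v := v)
      (by rintro _ ⟨p, hp, rfl⟩; exact hver p hp _ (hq p hp))
      (by rintro _ ⟨p, hp, rfl⟩; exact hvq p hp)
    rw [Set.InjOn.ncard_image] at this
    · exact_mod_cast this
    · intro p hp p' hp' h
      exact congrArg Prod.fst (hg ⟨hp, hq p hp⟩ ⟨hp', hq p' hp'⟩ h)
  · choose! p hp hvp using hv
    have := Θ.ncard_le_width (A := (fun q => g (p q, q)) '' Set.Icc (-m) m) (v := v)
      (by rintro _ ⟨q, hq, rfl⟩; exact hver _ (hp q hq) q hq)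
      (by rintro _ ⟨q, hq, rfl⟩; exact hvp q hq)
    rw [Set.InjOn.ncard_image] at this
    · exact_mod_cast this
    · intro q hq q' hq' h
      exact congrArg Prod.snd (hg ⟨hp q hq, hq⟩ ⟨hp q' hq', hq'⟩ h)

end Slicing

/-! ### The one-node slicing and attainment of the minimum -/

namespace SimplicialPoset

variable {d : ℕ} {K : SimplicialPoset}

/-- The connected sum of a single sphere. -/
def trivialSum (hK : K.IsCellSphere d) : TreeSumData d where
  Node := Unit
  tree := ⊥
  isTree := .of_subsingleton
  piece _ := K
  isCellSphere _ := hK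
  mark _ _ h := h.elim
  mark_mem _ _ h := h.elim
  admissible _ _ h := h.elim
  glue _ _ h := h.elim
  glue_symm _ _ h := h.elim
  mark_ne _ _ _ h := h.elim
  not_adjacent _ _ _ h := h.elim

theorem not_identified_trivialSum (hK : K.IsCellSphere d) (p q) :
    ¬ (trivialSum hK).Identified p q := fun h => h.1.elim

/-- The simplex of `K` that represents an element of the trivial connected sum. -/
def ofTrivialSum (hK : K.IsCellSphere d) : (trivialSum hK).Sum → K :=
  Quot.lift (fun p => p.2.1) fun p q h => (not_identified_trivialSum hK p q h).elim

/-- The slicing with a single node. -/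
noncomputable def trivialSlicing (hK : K.IsCellSphere d) : Slicing d K where
  data := trivialSum hK
  iso :=
    { toFun := fun I => (trivialSum hK).toSum () ⟨I, fun _ h => h.elim⟩
      invFun := ofTrivialSum hK
      left_inv := fun _ => rfl
      right_inv := by rintro ⟨⟨⟨⟩, I⟩⟩; rfl
      map_rel_iff' := by
        intro I J
        constructor
        · rintro ⟨⟨⟩, I', J', h, h1, h2⟩
          have e1 : I'.1 = I := congrArg (ofTrivialSum hK) h1
          have e2 : J'.1 = J := congrArg (ofTrivialSum hK) h2
          rw [← e1, ← e2]
          exact h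
        · intro h
          exact ⟨(), ⟨I, fun _ h => h.elim⟩, ⟨J, fun _ h => h.elim⟩, h, rfl, rfl⟩ }

theorem lt_fatness (hK : K.IsCellSphere d) {N : ℕ} (h : ∀ Θ : Slicing d K, N < Θ.data.width) :
    N < fatness d K := by
  -- The one-node slicing excludes the default value `sInf ∅ = 0`, so the infimum is attained.
  obtain ⟨Θ, hΘ⟩ := Nat.sInf_mem (s := {w | ∃ Θ : Slicing d K, Θ.data.width = w})
    ⟨_, trivialSlicing hK, rfl⟩
  exact (h Θ).trans_eq hΘ

end SimplicialPoset

/-! ### Geometric realization of an abstract simplicial complex -/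

namespace SimplicialPoset

variable {V : Type} [Fintype V] [DecidableEq V]

/-- The simplicial poset of an abstract simplicial complex, given by its faces. -/
def ofFaces (F : Finset V → Prop) (hempty : F ∅) (hdown : ∀ σ τ, F σ → τ ⊆ σ → F τ) :
    SimplicialPoset where
  Simplex := {σ : Finset V // F σ}
  orderBot := { bot := ⟨∅, hempty⟩, bot_le := fun σ => Finset.empty_subset σ.1 }
  boolean := by
    rintro ⟨σ, hσ⟩
    let e := σ.equivFin
    refine ⟨σ.card, ⟨⟨⟨fun τ => Finset.univ.filter fun j => (e.symm j : V) ∈ τ.1.1,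
      fun s => ⟨⟨s.image fun j => (e.symm j : V), hdown σ _ hσ ?_⟩, ?_⟩, ?_, ?_⟩, ?_⟩⟩⟩
    · intro v hv
      obtain ⟨j, -, rfl⟩ := Finset.mem_image.1 hv
      exact (e.symm j).2
    · intro v hv
      obtain ⟨j, -, rfl⟩ := Finset.mem_image.1 hv
      exact (e.symm j).2
    · rintro ⟨⟨τ, hτ⟩, hle⟩
      refine Subtype.ext (Subtype.ext ?_)
      ext v
      simp only [Finset.mem_image, Finset.mem_filter, Finset.mem_univ, true_and]
      constructor
      · rintro ⟨j, hj, rfl⟩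
        exact hj
      · intro hv
        exact ⟨e ⟨v, hle hv⟩, by simpa using hv, by simp⟩
    · intro s
      ext j
      simp
    · rintro ⟨⟨τ, hτ⟩, hle⟩ ⟨⟨τ', hτ'⟩, hle'⟩
      constructor
      · intro h v hv
        have : e ⟨v, hle hv⟩ ∈ Finset.univ.filter fun j => (e.symm j : V) ∈ τ' :=
          h (by simpa using hv)
        simpa using this
      · intro h j hj
        simp only [Equiv.coe_fn_mk, Finset.mem_filter, Finset.mem_univ, true_and] at hj ⊢
        exact h hj

variable {F : Finset V → Prop} {hempty : F ∅} {hdown : ∀ σ τ, F σ → τ ⊆ σ → F τ}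

theorem isAtom_ofFaces_iff {I : ofFaces F hempty hdown} : IsAtom I ↔ ∃ v, I.1 = {v} := by
  constructor
  · intro h
    have hne : I.1.Nonempty := Finset.nonempty_iff_ne_empty.2 fun h0 => h.1 (Subtype.ext h0)
    obtain ⟨v, hv⟩ := hne
    have hvI : {v} ⊆ I.1 := Finset.singleton_subset_iff.2 hv
    rcases h.le_iff.1 (show (⟨{v}, hdown _ _ I.2 hvI⟩ : ofFaces F hempty hdown) ≤ I from hvI)
      with h1 | h1
    · exact absurd (congrArg Subtype.val h1) (Finset.singleton_ne_empty v)
    · exact ⟨v, (congrArg Subtype.val h1).symm⟩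
  · rintro ⟨v, hv⟩
    constructor
    · intro h0
      rw [h0] at hv
      exact (Finset.singleton_ne_empty v).symm hv
    · intro J hJ
      have h1 : J.1 ⊆ {v} := hv ▸ hJ.le
      rcases Finset.subset_singleton_iff.1 h1 with h2 | h2
      · exact Subtype.ext h2
      · exact absurd (Subtype.ext (h2.trans hv.symm)) hJ.ne

theorem isComplex_ofFaces : (ofFaces F hempty hdown).IsComplex := by
  intro I J h
  refine Subtype.ext (Finset.ext fun v => ?_)
  have key : ∀ I J : ofFaces F hempty hdown,
      {i ∈ (ofFaces F hempty hdown).Ver | i ≤ I} = {i ∈ (ofFaces F hempty hdown).Ver | i ≤ J} →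
      v ∈ I.1 → v ∈ J.1 := by
    intro I J h hv
    have hvI : {v} ⊆ I.1 := Finset.singleton_subset_iff.2 hv
    have h1 : (⟨{v}, hdown _ _ I.2 hvI⟩ : ofFaces F hempty hdown) ∈
        {i ∈ (ofFaces F hempty hdown).Ver | i ≤ I} := ⟨isAtom_ofFaces_iff.2 ⟨v, rfl⟩, hvI⟩
    rw [h] at h1
    exact Finset.singleton_subset_iff.1 h1.2
  exact ⟨key I J h, key J I h.symm⟩

/-- The vertices of the complex as simplices. -/
def verOfFaces (hsing : ∀ v, F {v}) (v : V) : (ofFaces F hempty hdown).Ver :=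
  ⟨⟨{v}, hsing v⟩, isAtom_ofFaces_iff.2 ⟨v, rfl⟩⟩

theorem verOfFaces_bijective (hsing : ∀ v, F {v}) :
    Function.Bijective (verOfFaces (hempty := hempty) (hdown := hdown) hsing) := by
  constructor
  · intro v w h
    exact Finset.singleton_injective (congrArg (fun i => i.1.1) h)
  · rintro ⟨I, hI⟩
    obtain ⟨v, hv⟩ := isAtom_ofFaces_iff.1 hI
    exact ⟨v, Subtype.ext (Subtype.ext hv.symm)⟩

theorem verOfFaces_le_iff (hsing : ∀ v, F {v}) {v : V} {I : ofFaces F hempty hdown} :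
    ((verOfFaces hsing v : (ofFaces F hempty hdown).Ver) : ofFaces F hempty hdown) ≤ I ↔
      v ∈ I.1 :=
  Finset.singleton_subset_iff

/-- The points of the geometric realization of an abstract simplicial complex in barycentric
coordinates. -/
def barycentric (F : Finset V → Prop) : Set (V → ℝ) :=
  {t | (∀ v, 0 ≤ t v) ∧ ∑ v, t v = 1 ∧ F (Finset.univ.filter fun v => t v ≠ 0)}

theorem mem_geomSimplex_ofFaces_iff (hsing : ∀ v, F {v}) {I : ofFaces F hempty hdown}
    {x : (ofFaces F hempty hdown).Ver → ℝ} : x ∈ (ofFaces F hempty hdown).geomSimplex I ↔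
      (∀ v, 0 ≤ x (verOfFaces hsing v)) ∧ ∑ v, x (verOfFaces hsing v) = 1 ∧
        Finset.univ.filter (fun v => x (verOfFaces hsing v) ≠ 0) ⊆ I.1 := by
  let e := Equiv.ofBijective _ (verOfFaces_bijective (hempty := hempty) (hdown := hdown) hsing)
  refine and_congr e.forall_congr_right.symm (and_congr ?_ ?_)
  · rw [← finsum_comp_equiv e, finsum_eq_sum_of_fintype]
    rfl
  · rw [← e.forall_congr_right]
    refine forall_congr' fun v => ?_
    simp only [Finset.mem_filter, Finset.mem_univ, true_and]
    rw [not_imp_comm]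
    exact imp_congr Iff.rfl (verOfFaces_le_iff hsing)

theorem isCompact_geomSimplex_ofFaces (hsing : ∀ v, F {v}) (I : ofFaces F hempty hdown) :
    IsCompact ((ofFaces F hempty hdown).geomSimplex I) := by
  have := Fintype.ofBijective _ (verOfFaces_bijective (hempty := hempty) (hdown := hdown) hsing)
  refine IsCompact.of_isClosed_subset (isCompact_univ_pi fun _ => isCompact_Icc (a := (0 : ℝ))
    (b := 1)) ?_ ?_
  · simp only [geomSimplex, finsum_eq_sum_of_fintype, Set.ofPred_and, Set.ofPred_forall]
    refine (isClosed_iInter fun i => isClosed_le continuous_const (continuous_apply i)).inter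
      ((isClosed_eq (by fun_prop) continuous_const).inter
        (isClosed_iInter fun i => isClosed_iInter fun _ =>
          isClosed_eq (continuous_apply i) continuous_const))
  · rintro x ⟨h0, h1, -⟩ i -
    rw [finsum_eq_sum_of_fintype] at h1
    exact ⟨h0 i, h1 ▸ Finset.single_le_sum (fun j _ => h0 j) (Finset.mem_univ i)⟩

/-- The realization of a simplicial complex is homeomorphic to every Hausdorff space onto which
its points in barycentric coordinates are mapped bijectively and continuously. -/
theorem nonempty_homeomorph_realization (hsing : ∀ v, F {v}) {X : Type*} [TopologicalSpace X]
    [T2Space X] (f : barycentric F → X) (hf : Continuous f) (hbij : Function.Bijective f) :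
    Nonempty ((ofFaces F hempty hdown).Realization ≃ₜ X) := by
  let S := ofFaces F hempty hdown
  let ver : V → S.Ver := verOfFaces hsing
  let toBary : (Σ I : S, S.geomSimplex I) → barycentric F := fun p =>
    ⟨fun v => p.2.1 (ver v), by
      obtain ⟨h0, h1, h2⟩ := (mem_geomSimplex_ofFaces_iff hsing).1 p.2.2
      exact ⟨h0, h1, hdown _ _ p.1.2 h2⟩⟩
  have hcont : Continuous toBary := by
    refine continuous_sigma fun I => ?_
    refine Continuous.subtype_mk (continuous_pi fun v => ?_) _
    exact (continuous_apply (ver v)).comp continuous_subtype_val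
  let g : S.Realization → barycentric F := Quot.lift toBary fun p q h =>
    Subtype.ext (funext fun v => congrFun h.2 (ver v))
  have hg : Continuous g := continuous_quot_lift _ hcont
  have hginj : Function.Injective g := by
    -- Every point is identified with its copy in its carrier, the face of nonzero coordinates.
    -- Equal coordinates give equal carriers, hence equal classes.
    have key : ∀ p : Σ I : S, S.geomSimplex I, ∀ (J : S) (y : S.geomSimplex J), J ≤ p.1 →
        (p.2 : S.Ver → ℝ) = y → (Quot.mk _ p : S.Realization) = Quot.mk _ ⟨J, y⟩ :=
      fun p J y hJ hy => (Quot.sound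
        (r := fun p q : Σ I : S, S.geomSimplex I => p.1 ≤ q.1 ∧ (p.2 : S.Ver → ℝ) = q.2)
        (a := ⟨J, y⟩) (b := p) ⟨hJ, hy.symm⟩).symm
    rintro ⟨p⟩ ⟨q⟩ h
    have hpq : (p.2 : S.Ver → ℝ) = q.2 := by
      funext i
      obtain ⟨v, rfl⟩ := (verOfFaces_bijective hsing).2 i
      exact congrFun (congrArg Subtype.val h) v
    obtain ⟨h0, h1, h2⟩ := (mem_geomSimplex_ofFaces_iff hsing).1 p.2.2
    obtain ⟨-, -, h2'⟩ := (mem_geomSimplex_ofFaces_iff hsing).1 q.2.2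
    rw [← hpq] at h2'
    have hJ := (toBary p).2.2.2
    have hy : (p.2 : S.Ver → ℝ) ∈ S.geomSimplex ⟨_, hJ⟩ :=
      (mem_geomSimplex_ofFaces_iff hsing).2 ⟨h0, h1, subset_rfl⟩
    exact (key p ⟨_, hJ⟩ ⟨_, hy⟩ h2 rfl).trans (key q ⟨_, hJ⟩ ⟨_, hy⟩ h2' hpq.symm).symm
  have hgsurj : Function.Surjective g := by
    rintro ⟨t, h0, h1, h2⟩
    let e := Equiv.ofBijective ver (verOfFaces_bijective hsing)
    have he : ∀ v, t (e.symm (ver v)) = t v := fun v => congrArg t (e.symm_apply_apply v)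
    have hx : (fun i => t (e.symm i)) ∈ S.geomSimplex ⟨_, h2⟩ := by
      refine (mem_geomSimplex_ofFaces_iff hsing).2 ?_
      change (∀ v, 0 ≤ t (e.symm (ver v))) ∧ ∑ v, t (e.symm (ver v)) = 1 ∧
        Finset.univ.filter (fun v => t (e.symm (ver v)) ≠ 0) ⊆ _
      simp only [he]
      exact ⟨h0, h1, subset_rfl⟩
    exact ⟨Quot.mk _ ⟨⟨_, h2⟩, ⟨_, hx⟩⟩, Subtype.ext (funext he)⟩
  -- A quotient of finitely many compact simplices is compact, so a continuous bijection onto a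
  -- Hausdorff space is a homeomorphism.
  have hcomp : CompactSpace S.Realization := by
    have : ∀ I : S, CompactSpace (S.geomSimplex I) := fun I =>
      isCompact_iff_compactSpace.1 (isCompact_geomSimplex_ofFaces hsing I)
    exact inferInstanceAs (CompactSpace (Quot _))
  exact ⟨Continuous.homeoOfEquivCompactToT2
    (f := Equiv.ofBijective (f ∘ g) (hbij.comp ⟨hginj, hgsurj⟩)) (hf.comp hg)⟩

end SimplicialPoset

/-! ### Radial projection, tails of distributions and random rounding -/

open MeasureTheory

/-- Each ray from the origin meets either sphere exactly once. This passes from the sup norm to the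
Euclidean norm. -/
theorem bijective_normalize {E F : Type*} [NormedAddCommGroup E] [NormedSpace ℝ E]
    [NormedAddCommGroup F] [NormedSpace ℝ F] (e : E ≃L[ℝ] F) {r : ℝ} (hr : 0 < r) :
    ∃ f : Metric.sphere (0 : E) r → Metric.sphere (0 : F) 1,
      Continuous f ∧ Function.Bijective f := by
  have hne : ∀ x : Metric.sphere (0 : E) r, e x ≠ 0 := fun x h => by
    rw [e.map_eq_zero_iff] at h
    exact ne_zero_of_mem_sphere hr.ne' x h
  have hpos : ∀ x : Metric.sphere (0 : E) r, 0 < ‖e x‖ := fun x => norm_pos_iff.2 (hne x)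
  refine ⟨fun x => ⟨‖e x‖⁻¹ • e x, ?_⟩, ?_, ?_, ?_⟩
  · rw [mem_sphere_zero_iff_norm, norm_smul, norm_inv, norm_norm, inv_mul_cancel₀ (hpos x).ne']
  · refine Continuous.subtype_mk ?_ _
    exact ((e.continuous.comp continuous_subtype_val).norm.inv₀ fun x => (hpos x).ne').smul
      (e.continuous.comp continuous_subtype_val)
  · intro x y h
    have h1 : ‖e x‖⁻¹ • e x = ‖e y‖⁻¹ • e y := congrArg Subtype.val h
    rw [← map_smul, ← map_smul] at h1
    have h2 := e.injective h1
    have h3 : ‖e x‖⁻¹ = ‖e y‖⁻¹ := by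
      have := congrArg norm h2
      rw [norm_smul, norm_smul, norm_eq_of_mem_sphere, norm_eq_of_mem_sphere, norm_inv, norm_inv,
        norm_norm, norm_norm] at this
      exact mul_right_cancel₀ hr.ne' this
    rw [h3] at h2
    exact Subtype.ext (smul_right_injective E (inv_pos.2 (hpos y)).ne' h2)
  · rintro ⟨y, hy⟩
    rw [mem_sphere_zero_iff_norm] at hy
    have hy0 : e.symm y ≠ 0 := by
      rw [Ne, e.symm.map_eq_zero_iff]
      rintro rfl
      simp at hy
    have hn : 0 < ‖e.symm y‖ := norm_pos_iff.2 hy0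
    have hc : 0 < r / ‖e.symm y‖ := div_pos hr hn
    refine ⟨⟨(r / ‖e.symm y‖) • e.symm y, ?_⟩, ?_⟩
    · rw [mem_sphere_zero_iff_norm, norm_smul, Real.norm_of_nonneg hc.le,
        div_mul_cancel₀ _ hn.ne']
    · refine Subtype.ext ?_
      simp only [map_smul, ContinuousLinearEquiv.apply_symm_apply]
      rw [norm_smul, hy, mul_one, Real.norm_of_nonneg hc.le, smul_smul,
        inv_mul_cancel₀ hc.ne', one_smul]

/-- The upper tail of a distribution supported on two consecutive integers is determined by its
mean. -/
theorem sum_tail_eq {V : Type*} [Fintype V] {t : V → ℝ} (h0 : ∀ v, 0 ≤ t v)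
    (h1 : ∑ v, t v = 1) (c : V → ℤ) (hc : ∀ v w, t v ≠ 0 → t w ≠ 0 → c v ≤ c w + 1) (k : ℤ) :
    ∑ v with k ≤ c v, t v = max 0 (min 1 (1 + ∑ v, t v * c v - k)) := by
  by_cases hA : ∀ v, t v ≠ 0 → k ≤ c v
  · have e : ∑ v with k ≤ c v, t v = 1 := by
      rw [← h1]
      refine Finset.sum_subset (Finset.filter_subset _ _) fun v _ hv => ?_
      by_contra h
      exact hv (by simpa using hA v h)
    have e2 : (k : ℝ) ≤ ∑ v, t v * c v := by
      rw [← one_mul (k : ℝ), ← h1, Finset.sum_mul]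
      refine Finset.sum_le_sum fun v _ => ?_
      by_cases h : t v = 0
      · simp [h]
      · exact mul_le_mul_of_nonneg_left (by exact_mod_cast hA v h) (h0 v)
    rw [e, min_eq_left (by linarith), max_eq_right zero_le_one]
  by_cases hB : ∀ v, t v ≠ 0 → c v < k
  · have e : ∑ v with k ≤ c v, t v = 0 := by
      refine Finset.sum_eq_zero fun v hv => ?_
      by_contra h
      exact absurd (Finset.mem_filter.1 hv).2 (not_le.2 (hB v h))
    have e2 : ∑ v, t v * c v ≤ (k : ℝ) - 1 := by
      rw [show (k : ℝ) - 1 = ∑ v, t v * ((k : ℝ) - 1) by rw [← Finset.sum_mul, h1, one_mul]]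
      refine Finset.sum_le_sum fun v _ => ?_
      by_cases h : t v = 0
      · simp [h]
      · refine mul_le_mul_of_nonneg_left ?_ (h0 v)
        have := hB v h
        exact_mod_cast (by omega : c v ≤ k - 1)
    rw [e, max_eq_left]
    exact (min_le_right _ _).trans (by linarith)
  -- In the remaining case both sides of the threshold carry weight, so the values are `k - 1` and
  -- `k`, and the mean is `k - 1` plus the tail.
  push Not at hA hB
  obtain ⟨a, ha, hak⟩ := hA
  obtain ⟨b, hb, hbk⟩ := hB
  have e : ∑ v, t v * c v = (k - 1) + ∑ v with k ≤ c v, t v := by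
    rw [show (k : ℝ) - 1 = ∑ v, t v * ((k : ℝ) - 1) by rw [← Finset.sum_mul, h1, one_mul],
      Finset.sum_filter, ← Finset.sum_add_distrib]
    refine Finset.sum_congr rfl fun v _ => ?_
    by_cases h : t v = 0
    · simp [h]
    · have h2 := hc v a h ha
      have h3 := hc b v hb h
      split_ifs with h4
      · rw [show c v = k by omega]; ring
      · rw [show c v = k - 1 by omega]; push_cast; ring
  have h2 : 0 ≤ ∑ v with k ≤ c v, t v := Finset.sum_nonneg fun v _ => h0 v
  have h3 : ∑ v with k ≤ c v, t v ≤ 1 :=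
    h1 ▸ Finset.sum_le_sum_of_subset_of_nonneg (Finset.filter_subset _ _) fun v _ _ => h0 v
  rw [e, show (1 : ℝ) + (k - 1 + ∑ v with k ≤ c v, t v) - k = ∑ v with k ≤ c v, t v by ring,
    min_eq_right h3, max_eq_right h2]

/-- The floor is the identity minus the fractional part, which has mean `1 / 2` over every period.
-/
theorem setIntegral_floor_add (x : ℝ) : ∫ s in Set.Ico (0 : ℝ) 1, (⌊x + s⌋ : ℝ) = x := by
  have h1 : ∀ a : ℝ, IntervalIntegrable (fun s : ℝ => Int.fract s) volume a (a + 1) := fun a => by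
    refine (intervalIntegrable_const (c := (1 : ℝ))).mono_fun
      measurable_fract.aestronglyMeasurable (Filter.Eventually.of_forall fun s => ?_)
    simp only [Real.norm_eq_abs, abs_one, abs_of_nonneg (Int.fract_nonneg s)]
    exact (Int.fract_lt_one s).le
  have h2 : ∫ s in x..x + 1, Int.fract s = 1 / 2 := by
    rw [(Int.fract_periodic ℝ).intervalIntegral_add_eq x 0, zero_add,
      intervalIntegral.integral_of_le zero_le_one, ← integral_Ico_eq_integral_Ioc,
      setIntegral_congr_fun (g := fun s => s) measurableSet_Ico
        (fun s hs => Int.fract_eq_self.2 hs), integral_Ico_eq_integral_Ioc,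
      ← intervalIntegral.integral_of_le zero_le_one, integral_id]
    norm_num
  rw [integral_Ico_eq_integral_Ioc, ← intervalIntegral.integral_of_le zero_le_one,
    intervalIntegral.integral_comp_add_left (fun s => (⌊s⌋ : ℝ)) x, add_zero]
  have h3 : (fun s : ℝ => (⌊s⌋ : ℝ)) = fun s => s - Int.fract s := by
    funext s
    rw [Int.self_sub_fract]
  rw [h3, intervalIntegral.integral_sub intervalIntegral.intervalIntegrable_id (h1 x), h2, integral_id]
  ring

/-- The lattice points on the boundary of the cube `[-m, m]³`. -/
abbrev CubeVertex (m : ℤ) : Type := {v : Fin 3 → ℤ // (∀ i, |v i| ≤ m) ∧ ∃ i, |v i| = m}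

/-! ### The Freudenthal triangulation of the cube boundary -/

namespace CubeVertex

variable {m : ℤ}

instance : Finite (CubeVertex m) :=
  Set.Finite.subset (Set.finite_Icc (fun _ : Fin 3 => -m) (fun _ => m)) fun _ hv =>
    ⟨fun i => (abs_le.1 (hv.1 i)).1, fun i => (abs_le.1 (hv.1 i)).2⟩

noncomputable instance : Fintype (CubeVertex m) := Fintype.ofFinite _

/-- The faces of the Freudenthal triangulation: chains in a unit cube, inside a facet. -/
def IsFace (σ : Finset (CubeVertex m)) : Prop :=
  (∀ v ∈ σ, ∀ w ∈ σ, (v ≤ w ∨ w ≤ v) ∧ ∀ i, v.1 i ≤ w.1 i + 1) ∧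
    ∃ i, (∀ v ∈ σ, v.1 i = m) ∨ (∀ v ∈ σ, v.1 i = -m)

theorem isFace_empty : IsFace (∅ : Finset (CubeVertex m)) := ⟨by simp, 0, by simp⟩

theorem IsFace.mono (σ τ : Finset (CubeVertex m)) (h : IsFace σ) (hτ : τ ⊆ σ) : IsFace τ :=
  ⟨fun v hv w hw => h.1 v (hτ hv) w (hτ hw), h.2.imp fun _ h =>
    h.imp (fun h v hv => h v (hτ hv)) fun h v hv => h v (hτ hv)⟩

theorem isFace_singleton (v : CubeVertex m) : IsFace {v} := by
  refine ⟨by simp, v.2.2.imp fun i hi => ?_⟩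
  have := v.2.1 i
  simp only [Finset.mem_singleton, forall_eq]
  rcases abs_choice (v.1 i) with h | h <;> omega

open SimplicialPoset

/-- The point with given barycentric coordinates. -/
noncomputable def point (t : CubeVertex m → ℝ) : Fin 3 → ℝ := fun i => ∑ v, t v * v.1 i

theorem continuous_point : Continuous (point : (CubeVertex m → ℝ) → Fin 3 → ℝ) := by
  unfold point
  fun_prop

/-- Convexity bounds all coordinates by `m`, and the coordinate that is constant on the facet
attains the bound. -/
theorem norm_point (hm : 0 ≤ m) {t : CubeVertex m → ℝ} (ht : t ∈ barycentric IsFace) :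
    ‖point t‖ = m := by
  obtain ⟨h0, h1, -, i, hi⟩ := ht
  simp only [Finset.mem_filter, Finset.mem_univ, true_and] at hi
  have hm' : (0 : ℝ) ≤ m := by exact_mod_cast hm
  refine le_antisymm ((pi_norm_le_iff_of_nonneg hm').2 fun j => ?_) ?_
  · refine (norm_sum_le _ _).trans ?_
    rw [← one_mul (m : ℝ), ← h1, Finset.sum_mul]
    refine Finset.sum_le_sum fun v _ => ?_
    rw [norm_mul, Real.norm_of_nonneg (h0 v)]
    refine mul_le_mul_of_nonneg_left ?_ (h0 v)
    rw [Real.norm_eq_abs]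
    exact_mod_cast v.2.1 j
  · refine le_trans ?_ (norm_le_pi_norm (point t) i)
    have key : ∀ c : ℤ, (∀ v, t v ≠ 0 → v.1 i = c) → point t i = c := by
      intro c hc
      rw [← one_mul (c : ℝ), ← h1, Finset.sum_mul]
      refine Finset.sum_congr rfl fun v _ => ?_
      by_cases h : t v = 0
      · simp [h]
      · rw [hc v h]
    rcases hi with hi | hi
    · rw [key _ hi]
      exact le_abs_self _
    · rw [key _ hi, Real.norm_eq_abs]
      push_cast
      rw [abs_neg]
      exact le_abs_self _

open scoped Classical in
-- If no coordinate worked, each `i` would have a carrier vertex `w i` at least `v` in coordinate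
-- `i` but not above `v`. The carrier is a chain, so the largest of these three vertices dominates
-- `v` in all coordinates.
theorem exists_sum_le_eq {t : CubeVertex m → ℝ} (ht : t ∈ barycentric IsFace)
    (v : CubeVertex m) : ∃ i, ∑ w with v ≤ w, t w = ∑ w with v.1 i ≤ w.1 i, t w := by
  obtain ⟨h0, h1, ⟨hchain, -⟩⟩ := ht
  simp only [Finset.mem_filter, Finset.mem_univ, true_and] at hchain
  by_contra! hcon
  have : ∀ i, ∃ w, t w ≠ 0 ∧ v.1 i ≤ w.1 i ∧ ¬ v ≤ w := by
    intro i
    by_contra! h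
    refine hcon i (Finset.sum_subset (fun w hw => ?_) fun w hw hw' => ?_)
    · exact Finset.mem_filter.2 ⟨Finset.mem_univ _, (Finset.mem_filter.1 hw).2 i⟩
    · by_contra hne
      exact hw' (Finset.mem_filter.2 ⟨Finset.mem_univ _, h w hne (Finset.mem_filter.1 hw).2⟩)
  choose w hw hle hnle using this
  obtain ⟨a, ha, hmax⟩ := (Finset.univ.image w).exists_maximal (Finset.univ_nonempty.image w)
  obtain ⟨i, -, rfl⟩ := Finset.mem_image.1 ha
  have htop : ∀ j, w j ≤ w i := fun j => (hchain _ (hw j) _ (hw i)).1.elim id fun h =>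
    hmax (Finset.mem_image_of_mem w (Finset.mem_univ j)) h
  exact hnle i fun j => (hle j).trans (htop j j)

open scoped Classical in
-- Choose `i` for `t'`. The weight of `t` above `v` is at most its tail in coordinate `i`, which
-- depends only on the point, and for `t'` that tail is the weight above `v`. Exchange `t` and `t'`
-- for the other inequality.
theorem sum_le_eq_of_point_eq {t t' : CubeVertex m → ℝ} (ht : t ∈ barycentric IsFace)
    (ht' : t' ∈ barycentric IsFace) (h : point t = point t') (v : CubeVertex m) :
    ∑ w with v ≤ w, t w = ∑ w with v ≤ w, t' w := by
  have key : ∀ t t' : CubeVertex m → ℝ, t ∈ barycentric IsFace → t' ∈ barycentric IsFace →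
      point t = point t' → ∑ w with v ≤ w, t w ≤ ∑ w with v ≤ w, t' w := by
    intro t t' ht ht' h
    obtain ⟨i, hi⟩ := exists_sum_le_eq ht' v
    have tail : ∀ t : CubeVertex m → ℝ, t ∈ barycentric IsFace →
        ∑ w with v.1 i ≤ w.1 i, t w = max 0 (min 1 (1 + point t i - v.1 i)) := fun t ht =>
      sum_tail_eq ht.1 ht.2.1 (fun w => w.1 i) (fun w w' hw hw' =>
        (ht.2.2.1 w (by simpa using hw) w' (by simpa using hw')).2 i) _
    rw [hi, tail t' ht', ← h, ← tail t ht]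
    refine Finset.sum_le_sum_of_subset_of_nonneg (fun w hw => ?_) fun w _ _ => ht.1 w
    exact Finset.mem_filter.2 ⟨Finset.mem_univ _, (Finset.mem_filter.1 hw).2 i⟩
  exact le_antisymm (key t t' ht ht' h) (key t' t ht' ht h.symm)

theorem point_injOn : Set.InjOn (point : (CubeVertex m → ℝ) → _) (barycentric IsFace) := by
  classical
  intro t ht t' ht' h
  funext v
  -- The weights are recovered from the sums over upper sets by descending induction.
  induction v using WellFoundedGT.induction with
  | ind v ih =>
    have h1 := sum_le_eq_of_point_eq ht ht' h v
    have hsplit : ∀ t : CubeVertex m → ℝ,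
        ∑ w with v ≤ w, t w = t v + ∑ w with v < w, t w := by
      intro t
      rw [← Finset.sum_insert (by simp)]
      refine Finset.sum_congr (Finset.ext fun w => ?_) fun _ _ => rfl
      simp [le_iff_eq_or_lt, eq_comm]
    rw [hsplit, hsplit, Finset.sum_congr rfl fun w hw => ih w (Finset.mem_filter.1 hw).2] at h1
    exact add_right_cancel h1

/-- The lattice point below a translate of a point of the boundary of the cube. -/
theorem exists_floor_eq {x : Fin 3 → ℝ} (hx : ∀ i, |x i| ≤ m) (hx' : ∃ i, |x i| = m) {s : ℝ}
    (hs : s ∈ Set.Ico (0 : ℝ) 1) : ∃ v : CubeVertex m, ∀ i, ⌊x i + s⌋ = v.1 i := by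
  refine ⟨⟨fun i => ⌊x i + s⌋, fun i => abs_le.2 ⟨?_, ?_⟩, hx'.imp fun i hi => ?_⟩, fun i => rfl⟩
  · rw [Int.le_floor]
    push_cast
    linarith [(abs_le.1 (hx i)).1, hs.1]
  · refine Int.lt_add_one_iff.1 (Int.floor_lt.2 ?_)
    push_cast
    linarith [(abs_le.1 (hx i)).2, hs.2]
  -- A coordinate equal to `±m` is an integer, so a shift by `s < 1` does not change its floor.
  · have hs0 : ⌊s⌋ = 0 := Int.floor_eq_zero_iff.2 hs
    change |⌊x i + s⌋| = m
    rcases abs_choice (x i) with h | h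
    · rw [show x i = (m : ℝ) by linarith, Int.floor_intCast_add, hs0, add_zero, abs_eq_self]
      have : (0 : ℝ) ≤ m := hi ▸ abs_nonneg _
      exact_mod_cast this
    · rw [show x i = ((-m : ℤ) : ℝ) by push_cast; linarith, Int.floor_intCast_add, hs0, add_zero,
        abs_neg, abs_eq_self]
      have : (0 : ℝ) ≤ m := hi ▸ abs_nonneg _
      exact_mod_cast this

/-- The barycentric coordinates of `x` in the Freudenthal triangulation. -/
noncomputable def coords (x : Fin 3 → ℝ) (v : CubeVertex m) : ℝ :=
  volume.real ({s : ℝ | ∀ i, ⌊x i + s⌋ = v.1 i} ∩ Set.Ico 0 1)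

theorem measurableSet_floor_eq (x : Fin 3 → ℝ) (v : CubeVertex m) :
    MeasurableSet {s : ℝ | ∀ i, ⌊x i + s⌋ = v.1 i} := by
  rw [Set.ofPred_forall]
  exact MeasurableSet.iInter fun i =>
    (Int.measurable_floor.comp (measurable_const_add (x i))) (measurableSet_singleton _)

theorem exists_of_coords_ne_zero {x : Fin 3 → ℝ} {v : CubeVertex m} (h : coords x v ≠ 0) :
    ∃ s ∈ Set.Ico (0 : ℝ) 1, ∀ i, ⌊x i + s⌋ = v.1 i := by
  by_contra! hcon
  refine h ?_
  rw [coords, Set.eq_empty_of_forall_notMem (s := _ ∩ _), measureReal_empty]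
  rintro s ⟨hs, hs'⟩
  obtain ⟨i, hi⟩ := hcon s hs'
  exact hi (hs i)

/-- Both sides are the expectation of `g` at the random lattice point `⌊x + s⌋`, which always lies
on the cube boundary. -/
theorem sum_coords_mul {x : Fin 3 → ℝ} (hx : ∀ i, |x i| ≤ m) (hx' : ∃ i, |x i| = m)
    (g : (Fin 3 → ℤ) → ℝ) :
    ∑ v : CubeVertex m, coords x v * g v.1 =
      ∫ s in Set.Ico (0 : ℝ) 1, g fun i => ⌊x i + s⌋ := by
  have h1 : ∀ v : CubeVertex m, coords x v * g v.1 = ∫ s in Set.Ico (0 : ℝ) 1,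
      {s : ℝ | ∀ i, ⌊x i + s⌋ = v.1 i}.indicator (fun _ => g v.1) s := by
    intro v
    rw [integral_indicator_const _ (measurableSet_floor_eq x v),
      measureReal_restrict_apply (measurableSet_floor_eq x v), coords, smul_eq_mul]
  rw [Finset.sum_congr rfl fun v _ => h1 v, ← integral_finsetSum]
  · refine setIntegral_congr_fun measurableSet_Ico fun s hs => ?_
    obtain ⟨v, hv⟩ := exists_floor_eq hx hx' hs
    rw [Finset.sum_eq_single v]
    · rw [Set.indicator_of_mem (show s ∈ {s : ℝ | ∀ i, ⌊x i + s⌋ = v.1 i} from hv)]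
      exact congrArg g (funext fun i => (hv i).symm)
    · intro w _ hw
      refine Set.indicator_of_notMem (fun h => hw (Subtype.ext (funext fun i => ?_))) _
      exact (h i).symm.trans (hv i)
    · exact fun h => absurd (Finset.mem_univ v) h
  · exact fun v _ => (integrable_const _).indicator (measurableSet_floor_eq x v)

/-- As `s` grows, `⌊x + s⌋` increases by at most one in each coordinate, which gives a chain in a
unit cube. A coordinate equal to `±m` stays fixed, which gives the facet. -/
theorem coords_mem {x : Fin 3 → ℝ} (hx : ∀ i, |x i| ≤ m) (hx' : ∃ i, |x i| = m) :
    (coords x : CubeVertex m → ℝ) ∈ barycentric IsFace := by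
  refine ⟨fun v => measureReal_nonneg, ?_, ?_, ?_⟩
  · simpa using sum_coords_mul hx hx' fun _ => 1
  · intro v hv w hw
    obtain ⟨s, hs, hv⟩ := exists_of_coords_ne_zero (Finset.mem_filter.1 hv).2
    obtain ⟨s', hs', hw⟩ := exists_of_coords_ne_zero (Finset.mem_filter.1 hw).2
    constructor
    · rcases le_total s s' with h | h
      · left
        intro i
        rw [← hv i, ← hw i]
        gcongr
      · right
        intro i
        rw [← hv i, ← hw i]
        gcongr
    · intro i
      rw [← hv i, ← hw i, ← Int.floor_add_one]
      refine Int.floor_mono ?_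
      linarith [hs.2, hs'.1]
  · obtain ⟨i, hi⟩ := hx'
    refine ⟨i, ?_⟩
    have key : ∀ c : ℤ, x i = c → ∀ v ∈ Finset.univ.filter fun v : CubeVertex m => coords x v ≠ 0,
        v.1 i = c := by
      intro c hc v hv
      obtain ⟨s, hs, hv⟩ := exists_of_coords_ne_zero (Finset.mem_filter.1 hv).2
      rw [← hv i, hc, Int.floor_intCast_add, Int.floor_eq_zero_iff.2 hs, add_zero]
    rcases abs_choice (x i) with h | h
    · exact Or.inl (key m (by linarith))
    · exact Or.inr (key (-m) (by push_cast; linarith))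

theorem point_coords {x : Fin 3 → ℝ} (hx : ∀ i, |x i| ≤ m) (hx' : ∃ i, |x i| = m) :
    point (coords x : CubeVertex m → ℝ) = x := by
  funext i
  exact (sum_coords_mul hx hx' fun v => (v i : ℝ)).trans (setIntegral_floor_add (x i))

theorem point_surjOn (hm : 0 < m) :
    Set.SurjOn (point : (CubeVertex m → ℝ) → _) (barycentric IsFace)
      (Metric.sphere 0 (m : ℝ)) := by
  intro x hx
  rw [mem_sphere_zero_iff_norm] at hx
  have hx1 : ∀ i, |x i| ≤ m := fun i => hx ▸ norm_le_pi_norm x i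
  have hx2 : ∃ i, |x i| = m := by
    by_contra! h
    have : ‖x‖ < m := (pi_norm_lt_iff (by exact_mod_cast hm)).2 fun i =>
      lt_of_le_of_ne (hx1 i) (h i)
    exact this.ne hx
  exact ⟨_, coords_mem hx1 hx2, point_coords hx1 hx2⟩

/-- The boundary of the cube `[-m, m]³` with its Freudenthal triangulation. -/
noncomputable def cubeBoundary (m : ℤ) : SimplicialPoset :=
  ofFaces (IsFace : Finset (CubeVertex m) → Prop) isFace_empty IsFace.mono

theorem isSphere_cubeBoundary (hm : 0 < m) : (cubeBoundary m).IsSphere 2 := by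
  refine ⟨?_, isComplex_ofFaces⟩
  obtain ⟨f, hf, hbij⟩ := bijective_normalize (EuclideanSpace.equiv (Fin 3) ℝ).symm
    (show (0 : ℝ) < m by exact_mod_cast hm)
  let p : barycentric (IsFace : Finset (CubeVertex m) → Prop) →
      Metric.sphere (0 : Fin 3 → ℝ) (m : ℝ) := fun t =>
    ⟨point t.1, mem_sphere_zero_iff_norm.2 (norm_point hm.le t.2)⟩
  have hp : Continuous p := (continuous_point.comp continuous_subtype_val).subtype_mk _
  have hpb : Function.Bijective p := by
    constructor
    · exact fun t t' h => Subtype.ext (point_injOn t.2 t'.2 (congrArg Subtype.val h))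
    · intro x
      obtain ⟨t, ht, h⟩ := point_surjOn hm x.2
      exact ⟨⟨t, ht⟩, Subtype.ext h⟩
  exact nonempty_homeomorph_realization isFace_singleton (f ∘ p) (hf.comp hp) (hbij.comp hpb)

/-- The lattice points of the top facet. -/
def top (m : ℤ) (p : ℤ × ℤ) : Fin 3 → ℤ := ![p.1, p.2, m]

theorem top_mem {p q : ℤ} (hp : p ∈ Set.Icc (-m) m) (hq : q ∈ Set.Icc (-m) m) :
    (∀ i, |top m (p, q) i| ≤ m) ∧ ∃ i, |top m (p, q) i| = m := by
  have hm : 0 ≤ m := by have := hp.1.trans hp.2; omega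
  refine ⟨fun i => ?_, 2, abs_of_nonneg hm⟩
  fin_cases i
  · exact abs_le.2 hp
  · exact abs_le.2 hq
  · exact (abs_of_nonneg hm).le

open Classical in
/-- The vertices of the top facet. -/
noncomputable def topVertex (m : ℤ) (p : ℤ × ℤ) : cubeBoundary m :=
  if h : (∀ i, |top m p i| ≤ m) ∧ ∃ i, |top m p i| = m then ⟨{⟨top m p, h⟩}, isFace_singleton _⟩ else ⊥

theorem topVertex_eq {p q : ℤ} (hp : p ∈ Set.Icc (-m) m) (hq : q ∈ Set.Icc (-m) m) :
    topVertex m (p, q) = ⟨{⟨top m (p, q), top_mem hp hq⟩}, isFace_singleton _⟩ :=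
  dif_pos (top_mem hp hq)

/-- Neighbours in a row or a column of the top facet are comparable and differ by one in a single
coordinate, so they span an edge. -/
theorem exists_edge {p q p' q' : ℤ} (hp : p ∈ Set.Icc (-m) m) (hq : q ∈ Set.Icc (-m) m)
    (hp' : p' ∈ Set.Icc (-m) m) (hq' : q' ∈ Set.Icc (-m) m) (h1 : p ≤ p') (h2 : q ≤ q')
    (h3 : p' ≤ p + 1) (h4 : q' ≤ q + 1) :
    ∃ J, topVertex m (p, q) ≤ J ∧ topVertex m (p', q') ≤ J := by
  let v : CubeVertex m := ⟨_, top_mem hp hq⟩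
  let w : CubeVertex m := ⟨_, top_mem hp' hq'⟩
  have hvw : v ≤ w := by
    intro i
    fin_cases i
    exacts [h1, h2, le_rfl]
  have hwv : ∀ i, w.1 i ≤ v.1 i + 1 := by
    intro i
    fin_cases i
    exacts [h3, h4, (lt_add_one m).le]
  have hvw' : ∀ i, v.1 i ≤ w.1 i + 1 := fun i => (hvw i).trans (lt_add_one _).le
  have hface : IsFace {v, w} := by
    refine ⟨?_, 2, Or.inl ?_⟩
    · simp only [Finset.mem_insert, Finset.mem_singleton]
      rintro _ (rfl | rfl) _ (rfl | rfl)
      · exact ⟨Or.inl le_rfl, fun i => (lt_add_one _).le⟩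
      · exact ⟨Or.inl hvw, hvw'⟩
      · exact ⟨Or.inr hvw, hwv⟩
      · exact ⟨Or.inl le_rfl, fun i => (lt_add_one _).le⟩
    · simp only [Finset.mem_insert, Finset.mem_singleton]
      rintro _ (rfl | rfl) <;> rfl
  rw [topVertex_eq hp hq, topVertex_eq hp' hq']
  refine ⟨⟨{v, w}, hface⟩, ?_, ?_⟩
  · exact Finset.singleton_subset_iff.2 (Finset.mem_insert_self v {w})
  · exact Finset.singleton_subset_iff.2 (Finset.mem_insert_of_mem (Finset.mem_singleton_self w))

theorem le_width_cubeBoundary (hm : 0 ≤ m) (Θ : Slicing 2 (cubeBoundary m)) :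
    2 * m + 1 ≤ Θ.data.width := by
  refine Θ.width_ge_of_grid hm (topVertex m) ?_ ?_ ?_ ?_
  · rintro ⟨p, q⟩ ⟨hp, hq⟩ ⟨p', q'⟩ ⟨hp', hq'⟩ h
    rw [topVertex_eq hp hq, topVertex_eq hp' hq'] at h
    have h1 : top m (p, q) = top m (p', q') :=
      congrArg Subtype.val (Finset.singleton_injective (congrArg Subtype.val h))
    exact Prod.ext (congrFun h1 0) (congrFun h1 1)
  · intro p hp q hq
    rw [topVertex_eq hp hq]
    exact isAtom_ofFaces_iff.2 ⟨_, rfl⟩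
  · intro p hp q h1 h2
    exact exists_edge hp ⟨h1, by omega⟩ hp ⟨by omega, h2⟩ le_rfl (by omega) (by omega) le_rfl
  · intro q hq p h1 h2
    exact exists_edge ⟨h1, by omega⟩ hq ⟨by omega, h2⟩ hq (by omega) le_rfl le_rfl (by omega)

end CubeVertex

theorem mainTheorem5 (N : ℕ) (hN : 0 < N) :
    ∃ K : SimplicialPoset, K.IsSphere 2 ∧ N < fatness 2 K := by
  -- The choice `m = N` is generous: it gives width at least `2N + 1`.
  have hK := CubeVertex.isSphere_cubeBoundary (m := N) (by exact_mod_cast hN)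
  refine ⟨_, hK, SimplicialPoset.lt_fatness hK.1 fun Θ => ?_⟩
  have := CubeVertex.le_width_cubeBoundary (by omega) Θ
  omega
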